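/- Let $(\Omega,\Sigma,\mu)$ be an arbitrary measure space, let $1\le p<\infty$, let $p'=p/(p-1)$ be the conjugate exponent of $p$ ($p'=\infty$ if $p=1$), and let $f_1,\dots,f_n$ be elements of the complex space $L^p(\mu)$ with norm $\|\cdot\|_p$. Let $\lambda$ be the normalized Haar measure on $\mathbb{T}^n$, the $n$-fold product of the circle group $\mathbb{T}=\{z\in\mathbb{C}:|z|=1\}$, so that $d\lambda(\theta)=(1/2\pi)^n\,d\theta_1\cdots d\theta_n$. Then $$\Bigl(\int_{\mathbb{T}^n}\Bigl\|\sum_{j=1}^n f_je^{i\theta_j}\Bigr\|_p^{p'}\,d\lambda(\theta)\Bigr)^{1/p'}\le\Bigl(\sum_{j=1}^n\|f_j\|_p^p\Bigr)^{1/p}\qquad\text{for }1\le p\le 2,$$ and $$\Bigl(\int_{\mathbb{T}^n}\Bigl\|\sum_{j=1}^n f_je^{i\theta_j}\Bigr\|_p^{p}\,d\lambda(\theta)\Bigr)^{1/p}\le\Bigl(\sum_{j=1}^n\|f_j\|_p^{p'}\Bigr)^{1/p'}\qquad\text{for }2\le p<\infty.$$ For $p=1$ the left-hand side of the first inequality is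 read as $\sup_{\theta_1,\dots,\theta_n}\bigl\|\sum_{j=1}^n f_je^{i\theta_j}\bigr\|_1$. The integrals are finite. -/

import Mathlib

open MeasureTheory

/-- The Borel σ-algebra on the circle group `𝕋 = {z ∈ ℂ : |z| = 1}`. -/
noncomputable instance Clarkson.instMeasurableSpaceCircle : MeasurableSpace Circle := borel Circle

instance Clarkson.instBorelSpaceCircle : BorelSpace Circle := ⟨rfl⟩

/-- The normalized Haar measure `λ` on the compact group `𝕋ⁿ` (total mass one), that is,
`dλ(θ) = (1/2π)ⁿ dθ₁ ⋯ dθₙ` in the coordinates `z_j = e^{iθ_j}`. -/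
noncomputable def Clarkson.torusHaar (n : ℕ) : Measure (Fin n → Circle) :=
  Measure.haarMeasure ⊤

/-- The function `∑ⱼ f_j e^{iθ_j}` on `𝕋ⁿ` with values in the complex space `L^p(μ)`;
the point of the torus is `z = (e^{iθ_1}, …, e^{iθ_n})`. -/
noncomputable def Clarkson.steinhausSum {Ω : Type*} [MeasurableSpace Ω] {μ : Measure Ω}
    {p : ENNReal} {n : ℕ} (f : Fin n → Lp ℂ p μ) (z : Fin n → Circle) : Lp ℂ p μ :=
  ∑ j, (z j : ℂ) • f j

namespace Clarkson

/-! Everything rests on Clarkson's two-point inequality ‖x + y‖^q + ‖x - y‖^q ≤ 2(‖x‖^r +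
‖y‖^r)^(q/r), with q ≥ 2 and r conjugate to q. For complex numbers it follows, by duality, from a
three-lines bound for a bilinear form (`norm_two_point_form_le_rpow`). Minkowski's inequality
carries it to `L^p`, with q the larger of p and p'.

To reach n summands, note that Haar measure is invariant under z_k ↦ -z_k. So the integral of ‖X +
z_k f_k‖^q, X the sum of the other terms, is unchanged by averaging over the two signs, and the
two-point inequality bounds it by the integral of (‖X‖^r + ‖f_k‖^r)^(q/r). Minkowski in L^(q/r) and
induction on the number of terms finish. For p = 1 the triangle inequality suffices. -/

/-- The entire function `w ↦ (x / ‖x‖) ‖x‖ ^ w`, identically zero when `x = 0`. -/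
noncomputable def polarPow (x w : ℂ) : ℂ := x / ‖x‖ * Complex.exp (w * Real.log ‖x‖)

/-- Equality can fail only at x = 0 with Re w = 0, since `0 ^ 0 = 1`. -/
lemma norm_polarPow_le (x w : ℂ) : ‖polarPow x w‖ ≤ ‖x‖ ^ w.re := by
  rcases eq_or_ne x 0 with rfl | hx
  · simpa [polarPow] using Real.rpow_nonneg le_rfl w.re
  · have hx' : 0 < ‖x‖ := norm_pos_iff.2 hx
    rw [polarPow, norm_mul, Complex.norm_exp, Real.rpow_def_of_pos hx']
    simp [hx'.ne', mul_comm]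

lemma polarPow_one (x : ℂ) : polarPow x 1 = x := by
  rcases eq_or_ne x 0 with rfl | hx
  · simp [polarPow]
  · have hx' : 0 < ‖x‖ := norm_pos_iff.2 hx
    rw [polarPow, one_mul, ← Complex.ofReal_exp, Real.exp_log hx']
    exact div_mul_cancel₀ _ (by exact_mod_cast hx'.ne')

lemma differentiable_polarPow (x : ℂ) : Differentiable ℂ (polarPow x) := by
  unfold polarPow
  fun_prop

/-- The ℓ¹ endpoint of the interpolation. -/
lemma norm_two_point_form_le (a b c d : ℂ) :
    ‖c * (a + b) + d * (a - b)‖ ≤ (‖a‖ + ‖b‖) * (‖c‖ + ‖d‖) := by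
  calc ‖c * (a + b) + d * (a - b)‖ ≤ ‖c‖ * ‖a + b‖ + ‖d‖ * ‖a - b‖ := by
        simpa using norm_add_le (c * (a + b)) (d * (a - b))
    _ ≤ ‖c‖ * (‖a‖ + ‖b‖) + ‖d‖ * (‖a‖ + ‖b‖) := by
        gcongr
        · exact norm_add_le a b
        · exact norm_sub_le a b
    _ = _ := by ring

/-- The ℓ² endpoint: Cauchy–Schwarz, then the parallelogram law. -/
lemma norm_two_point_form_sq_le (a b c d : ℂ) :
    ‖c * (a + b) + d * (a - b)‖ ^ 2 ≤ 2 * ((‖a‖ ^ 2 + ‖b‖ ^ 2) * (‖c‖ ^ 2 + ‖d‖ ^ 2)) := by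
  have h1 : ‖c * (a + b) + d * (a - b)‖ ≤ ‖c‖ * ‖a + b‖ + ‖d‖ * ‖a - b‖ := by
    simpa using norm_add_le (c * (a + b)) (d * (a - b))
  have h2 := parallelogram_law_with_norm ℝ a b
  calc ‖c * (a + b) + d * (a - b)‖ ^ 2 ≤ (‖c‖ * ‖a + b‖ + ‖d‖ * ‖a - b‖) ^ 2 := by gcongr
    _ ≤ (‖c‖ ^ 2 + ‖d‖ ^ 2) * (‖a + b‖ * ‖a + b‖ + ‖a - b‖ * ‖a - b‖) := by
        nlinarith [sq_nonneg (‖c‖ * ‖a - b‖ - ‖d‖ * ‖a + b‖)]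
    _ = _ := by linear_combination (‖c‖ ^ 2 + ‖d‖ ^ 2) * h2

/-- The bilinear form of Clarkson's inequality, by interpolation between `ℓ¹` and `ℓ²`. -/
lemma norm_two_point_form_le_rpow {q r : ℝ} (hq : 2 ≤ q) (hqr : r.HolderConjugate q)
    (a b c d : ℂ) :
    ‖c * (a + b) + d * (a - b)‖ ≤
      2 ^ (1 / q) * ((‖a‖ ^ r + ‖b‖ ^ r) * (‖c‖ ^ r + ‖d‖ ^ r)) ^ (1 / r) := by
  have hr0 : 0 < r := hqr.pos
  have hq0 : 0 < q := hqr.symm.pos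
  -- The exponent has real part r on Re z = 0 (ℓ¹ bound) and r/2 on Re z = 1 (ℓ² bound); it equals 1
  -- at z = 2/q, where `F` is the original form.
  set w : ℂ → ℂ := fun z => r * (1 - z / 2) with hw
  have hwre : ∀ z, (w z).re = r * (1 - z.re / 2) := fun z => by simp [hw]
  set F : ℂ → ℂ := fun z => polarPow c (w z) * (polarPow a (w z) + polarPow b (w z)) +
    polarPow d (w z) * (polarPow a (w z) - polarPow b (w z)) with hF
  have hwd : Differentiable ℂ w := by rw [hw]; fun_prop
  have hd (x : ℂ) : Differentiable ℂ fun z => polarPow x (w z) :=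
    (differentiable_polarPow x).comp hwd
  have hFd : Differentiable ℂ F :=
    ((hd c).mul ((hd a).add (hd b))).add ((hd d).mul ((hd a).sub (hd b)))
  have hbd : ∀ (x z : ℂ), z ∈ Complex.HadamardThreeLines.verticalClosedStrip 0 1 →
      ‖polarPow x (w z)‖ ≤ (1 + ‖x‖) ^ r := fun x z hz => by
    have hz' : 0 ≤ z.re ∧ z.re ≤ 1 := hz
    refine (norm_polarPow_le x _).trans ?_
    rw [hwre]
    calc ‖x‖ ^ (r * (1 - z.re / 2)) ≤ (1 + ‖x‖) ^ (r * (1 - z.re / 2)) := by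
          refine Real.rpow_le_rpow (norm_nonneg _) (by linarith [norm_nonneg x]) ?_
          exact mul_nonneg hr0.le (by linarith)
      _ ≤ (1 + ‖x‖) ^ r := by
          refine Real.rpow_le_rpow_of_exponent_le (by linarith [norm_nonneg x]) ?_
          exact mul_le_of_le_one_right hr0.le (by linarith)
  have hB : BddAbove ((norm ∘ F) '' Complex.HadamardThreeLines.verticalClosedStrip 0 1) := by
    refine ⟨((1 + ‖a‖) ^ r + (1 + ‖b‖) ^ r) * ((1 + ‖c‖) ^ r + (1 + ‖d‖) ^ r), ?_⟩
    rintro _ ⟨z, hz, rfl⟩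
    refine (norm_two_point_form_le _ _ _ _).trans ?_
    gcongr <;> exact hbd _ z hz
  have h0 : ∀ z ∈ Complex.re ⁻¹' {(0 : ℝ)},
      ‖F z‖ ≤ (‖a‖ ^ r + ‖b‖ ^ r) * (‖c‖ ^ r + ‖d‖ ^ r) := fun z hz => by
    have hx (x : ℂ) : ‖polarPow x (w z)‖ ≤ ‖x‖ ^ r := by
      have h := norm_polarPow_le x (w z)
      rw [hwre, show z.re = 0 from hz] at h
      simpa using h
    refine (norm_two_point_form_le _ _ _ _).trans ?_
    gcongr <;> exact hx _
  have h1 : ∀ z ∈ Complex.re ⁻¹' {(1 : ℝ)},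
      ‖F z‖ ≤ √(2 * ((‖a‖ ^ r + ‖b‖ ^ r) * (‖c‖ ^ r + ‖d‖ ^ r))) := fun z hz => by
    have hx (x : ℂ) : ‖polarPow x (w z)‖ ^ 2 ≤ ‖x‖ ^ r := by
      have h := norm_polarPow_le x (w z)
      rw [hwre, show z.re = 1 from hz] at h
      calc ‖polarPow x (w z)‖ ^ 2 ≤ (‖x‖ ^ (r * (1 - 1 / 2))) ^ 2 := by gcongr
        _ = ‖x‖ ^ r := by
          rw [← Real.rpow_natCast, ← Real.rpow_mul (norm_nonneg _)]
          congr 1; push_cast; ring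
    refine Real.le_sqrt_of_sq_le ((norm_two_point_form_sq_le _ _ _ _).trans ?_)
    gcongr <;> exact hx _
  have ht0 : 0 ≤ 2 / q := by positivity
  have ht1 : 2 / q ≤ 1 := (div_le_one hq0).2 hq
  have key := Complex.HadamardThreeLines.norm_le_interp_of_mem_verticalClosedStrip₀₁' F
    (z := ((2 / q : ℝ) : ℂ)) ⟨by simpa using ht0, by simpa using ht1⟩ hFd.diffContOnCl hB h0 h1
  have hinv := hqr.inv_add_inv_eq_one
  have hwt : w ((2 / q : ℝ) : ℂ) = 1 := by
    have : r * (1 - 2 / q / 2) = 1 := by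
      have : 1 - 2 / q / 2 = r⁻¹ := by rw [← hinv]; ring
      rw [this, mul_inv_cancel₀ hr0.ne']
    simp only [hw]; exact_mod_cast congrArg ((↑) : ℝ → ℂ) this
  have hFt : F ((2 / q : ℝ) : ℂ) = c * (a + b) + d * (a - b) := by
    simp only [hF, hwt, polarPow_one]
  rw [hFt, Complex.ofReal_re] at key
  refine key.trans_eq ?_
  set M := (‖a‖ ^ r + ‖b‖ ^ r) * (‖c‖ ^ r + ‖d‖ ^ r)
  have hM : 0 ≤ M := by positivity
  rw [Real.sqrt_eq_rpow, ← Real.rpow_mul (by positivity), Real.mul_rpow zero_le_two hM]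
  rw [mul_left_comm, ← Real.rpow_add_of_nonneg hM (by linarith) (by positivity)]
  have e : 1 - 2 / q + 1 / 2 * (2 / q) = 1 / r := by rw [one_div r, ← sub_eq_of_eq_add hinv.symm]; ring
  rw [e]; congr 2; ring

/-- Clarkson's inequality for two complex numbers. -/
lemma norm_add_rpow_add_norm_sub_rpow_le {q r : ℝ} (hq : 2 ≤ q) (hqr : r.HolderConjugate q)
    (a b : ℂ) :
    ‖a + b‖ ^ q + ‖a - b‖ ^ q ≤ 2 * (‖a‖ ^ r + ‖b‖ ^ r) ^ (q / r) := by
  have hr0 : 0 < r := hqr.pos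
  have hq0 : 0 < q := hqr.symm.pos
  have hinv := hqr.inv_add_inv_eq_one
  have hqr' : (q - 1) * r = q := hqr.symm.sub_one_mul_conj
  -- Extremal dual coefficients: they turn the bilinear form into S, and its dual factor into
  -- S^(1/r), which is then cancelled.
  have hu (x : ℂ) : ∃ c : ℂ, c * x = ((‖x‖ ^ q : ℝ) : ℂ) ∧ ‖c‖ ^ r = ‖x‖ ^ q := by
    rcases eq_or_ne x 0 with rfl | hx
    · exact ⟨0, by simp [hq0.ne'], by simp [hq0.ne', hr0.ne']⟩
    · have hx' : 0 < ‖x‖ := norm_pos_iff.2 hx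
      refine ⟨((‖x‖ ^ q : ℝ) : ℂ) / x, div_mul_cancel₀ _ hx, ?_⟩
      rw [norm_div, Complex.norm_real, Real.norm_of_nonneg (by positivity),
        ← Real.rpow_sub_one hx'.ne', ← Real.rpow_mul hx'.le, hqr']
  obtain ⟨c, hc, hc'⟩ := hu (a + b)
  obtain ⟨d, hd, hd'⟩ := hu (a - b)
  have key := norm_two_point_form_le_rpow hq hqr a b c d
  rw [hc, hd, hc', hd', ← Complex.ofReal_add, Complex.norm_real,
    Real.norm_of_nonneg (by positivity)] at key
  set S := ‖a + b‖ ^ q + ‖a - b‖ ^ q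
  set A := ‖a‖ ^ r + ‖b‖ ^ r
  have hA : 0 ≤ A := by positivity
  have hS : 0 ≤ S := by positivity
  rcases hS.eq_or_lt with h | hS
  · rw [← h]; positivity
  have h1 : S ^ (1 / q) ≤ 2 ^ (1 / q) * A ^ (1 / r) := by
    rw [Real.mul_rpow hA hS.le, ← mul_assoc] at key
    have : S = S ^ (1 / q) * S ^ (1 / r) := by
      rw [← Real.rpow_add hS, one_div, one_div, add_comm, hinv, Real.rpow_one]
    nth_rewrite 1 [this] at key
    exact le_of_mul_le_mul_right key (by positivity)
  calc S = (S ^ (1 / q)) ^ q := by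
        rw [← Real.rpow_mul hS.le, one_div_mul_cancel hq0.ne', Real.rpow_one]
    _ ≤ (2 ^ (1 / q) * A ^ (1 / r)) ^ q := by gcongr
    _ = 2 * A ^ (q / r) := by
        rw [Real.mul_rpow (by positivity) (by positivity), ← Real.rpow_mul zero_le_two,
          ← Real.rpow_mul hA, one_div_mul_cancel hq0.ne', Real.rpow_one]
        congr 2; ring

/-! ### Minkowski inequalities -/

/-- Minkowski's inequality for nonnegative real functions. -/
lemma integral_add_rpow_le {α : Type*} [MeasurableSpace α] {ν : Measure α} {u v : α → ℝ} {s : ℝ}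
    (hs : 1 ≤ s) (hu0 : 0 ≤ u) (hv0 : 0 ≤ v)
    (hu : AEStronglyMeasurable u ν) (hv : AEStronglyMeasurable v ν)
    (hui : Integrable (fun x => u x ^ s) ν) (hvi : Integrable (fun x => v x ^ s) ν) :
    Integrable (fun x => (u x + v x) ^ s) ν ∧
      ∫ x, (u x + v x) ^ s ∂ν ≤
        ((∫ x, u x ^ s ∂ν) ^ (1 / s) + (∫ x, v x ^ s ∂ν) ^ (1 / s)) ^ s := by
  have hs0 : 0 < s := by linarith
  have hp0 : ENNReal.ofReal s ≠ 0 := by simpa using hs0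
  have hpt : ENNReal.ofReal s ≠ ⊤ := ENNReal.ofReal_ne_top
  have hnorm {g : α → ℝ} (hg0 : 0 ≤ g) (x : α) :
      ‖g x‖ ^ (ENNReal.ofReal s).toReal = g x ^ s := by
    rw [Real.norm_of_nonneg (hg0 x), ENNReal.toReal_ofReal hs0.le]
  have hmem {g : α → ℝ} (hg0 : 0 ≤ g) (hg : AEStronglyMeasurable g ν) :
      Integrable (fun x => g x ^ s) ν ↔ MemLp g (ENNReal.ofReal s) ν := by
    rw [← integrable_norm_rpow_iff hg hp0 hpt]
    simp only [hnorm hg0]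
  have hlp {g : α → ℝ} (hg0 : 0 ≤ g) (hg : AEStronglyMeasurable g ν) :
      lpNorm g (ENNReal.ofReal s) ν = (∫ x, g x ^ s ∂ν) ^ (1 / s) := by
    rw [lpNorm_eq_integral_norm_rpow_toReal hp0 hpt hg]
    simp only [hnorm hg0]
    rw [ENNReal.toReal_ofReal hs0.le, one_div]
  have huv0 : 0 ≤ u + v := add_nonneg hu0 hv0
  have hmu := (hmem hu0 hu).1 hui
  have hmv := (hmem hv0 hv).1 hvi
  refine ⟨(hmem huv0 (hu.add hv)).2 (hmu.add hmv), ?_⟩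
  have h := lpNorm_add_le (g := v) hmu (by simpa using hs)
  rw [hlp huv0 (hu.add hv), hlp hu0 hu, hlp hv0 hv] at h
  have hI : 0 ≤ ∫ x, (u x + v x) ^ s ∂ν :=
    integral_nonneg fun x => Real.rpow_nonneg (huv0 x) s
  calc ∫ x, (u x + v x) ^ s ∂ν = ((∫ x, (u x + v x) ^ s ∂ν) ^ (1 / s)) ^ s := by
        rw [← Real.rpow_mul hI, one_div_mul_cancel hs0.ne', Real.rpow_one]
    _ ≤ _ := Real.rpow_le_rpow (Real.rpow_nonneg hI _) h hs0.le

/-- Minkowski's integral inequality over a two-point space. -/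
lemma integral_rpow_add_integral_rpow_le {α : Type*} [MeasurableSpace α] {ν : Measure α}
    {u v w : α → ℝ} {s : ℝ} (hs : 1 < s) (hu0 : 0 ≤ u) (hv0 : 0 ≤ v) (hw0 : 0 ≤ w)
    (hu : Integrable u ν) (hv : Integrable v ν) (hw : Integrable w ν)
    (h : ∀ᵐ x ∂ν, u x ^ s + v x ^ s ≤ w x ^ s) :
    (∫ x, u x ∂ν) ^ s + (∫ x, v x ∂ν) ^ s ≤ (∫ x, w x ∂ν) ^ s := by
  have hs0 : 0 < s := by linarith
  have hss : s.HolderConjugate s.conjExponent := Real.HolderConjugate.conjExponent hs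
  set s' := s.conjExponent
  set U := ∫ x, u x ∂ν
  set V := ∫ x, v x ∂ν
  set W := ∫ x, w x ∂ν
  have hU : 0 ≤ U := integral_nonneg hu0
  have hV : 0 ≤ V := integral_nonneg hv0
  have hW : 0 ≤ W := integral_nonneg hw0
  set D := U ^ s + V ^ s with hD
  have hD0 : 0 ≤ D := by positivity
  rcases hD0.eq_or_lt with hz | hDpos
  · rw [← hz]; positivity
  have hpow {t : ℝ} (ht : 0 ≤ t) : (t ^ (s - 1)) ^ s' = t ^ s := by
    rw [← Real.rpow_mul ht, hss.sub_one_mul_conj]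
  have hmul {t : ℝ} (ht : 0 ≤ t) : t ^ s = t * t ^ (s - 1) := by
    rw [← Real.rpow_one_add' ht (by linarith)]; congr 1; ring
  -- Hölder against (U^(s-1), V^(s-1)), the dual vector of (U, V); integrating turns the left side
  -- into D.
  have hpt : ∀ᵐ x ∂ν, u x * U ^ (s - 1) + v x * V ^ (s - 1) ≤ w x * D ^ (1 / s') := by
    filter_upwards [h] with x hx
    have key := Real.inner_le_Lp_mul_Lq_of_nonneg (s := Finset.univ) (f := ![u x, v x])
      (g := ![U ^ (s - 1), V ^ (s - 1)]) hss
      (by intro i _; fin_cases i; exacts [hu0 x, hv0 x])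
      (by intro i _; fin_cases i <;> simp <;> positivity)
    simp only [Fin.sum_univ_two, Matrix.cons_val_zero, Matrix.cons_val_one, hpow hU, hpow hV]
      at key
    refine key.trans ?_
    rw [← hD]
    refine mul_le_mul_of_nonneg_right ?_ (by positivity)
    have hux : 0 ≤ u x := hu0 x
    have hvx : 0 ≤ v x := hv0 x
    calc (u x ^ s + v x ^ s) ^ (1 / s) ≤ (w x ^ s) ^ (1 / s) := by gcongr
      _ = w x := by rw [← Real.rpow_mul (hw0 x), mul_one_div_cancel hs0.ne', Real.rpow_one]
  have hint := integral_mono_ae ((hu.mul_const (U ^ (s - 1))).add (hv.mul_const (V ^ (s - 1))))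
    (hw.mul_const (D ^ (1 / s'))) hpt
  rw [integral_add' (hu.mul_const _) (hv.mul_const _), integral_mul_const, integral_mul_const,
    integral_mul_const, ← hmul hU, ← hmul hV, ← hD] at hint
  have hDs : D = D ^ (1 / s) * D ^ (1 / s') := by
    rw [← Real.rpow_add hDpos, one_div, one_div, hss.inv_add_inv_eq_one, Real.rpow_one]
  nth_rewrite 1 [hDs] at hint
  have h1 := le_of_mul_le_mul_right hint (by positivity)
  calc D = (D ^ (1 / s)) ^ s := by
        rw [← Real.rpow_mul hD0, one_div_mul_cancel hs0.ne', Real.rpow_one]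
    _ ≤ W ^ s := by gcongr

/-! ### Clarkson's inequalities in `L^p` -/

section Lp

variable {Ω : Type*} [MeasurableSpace Ω] {μ : Measure Ω} {p : ℝ}

lemma integrable_norm_coeFn_rpow (hp : 0 < p) (F : Lp ℂ (ENNReal.ofReal p) μ) :
    Integrable (fun x => ‖F x‖ ^ p) μ := by
  have h := (Lp.memLp F).integrable_norm_rpow (by simpa using hp) ENNReal.ofReal_ne_top
  rwa [ENNReal.toReal_ofReal hp.le] at h

lemma norm_rpow_eq_integral (hp : 0 < p) (F : Lp ℂ (ENNReal.ofReal p) μ) :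
    ‖F‖ ^ p = ∫ x, ‖F x‖ ^ p ∂μ := by
  rw [Lp.norm_def, toReal_eLpNorm (Lp.aestronglyMeasurable F),
    lpNorm_eq_integral_norm_rpow_toReal (by simpa using hp) ENNReal.ofReal_ne_top
      (Lp.aestronglyMeasurable F), ENNReal.toReal_ofReal hp.le,
    ← Real.rpow_mul (integral_nonneg fun x => by positivity), inv_mul_cancel₀ hp.ne', Real.rpow_one]

variable [Fact (1 ≤ ENNReal.ofReal p)]

/-- Clarkson's inequality in `L^p`, `2 ≤ p`. -/
lemma Lp_norm_add_rpow_add_norm_sub_rpow_le_of_two_le {r : ℝ} (hp : 2 ≤ p)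
    (hpr : r.HolderConjugate p) (F G : Lp ℂ (ENNReal.ofReal p) μ) :
    ‖F + G‖ ^ p + ‖F - G‖ ^ p ≤ 2 * (‖F‖ ^ r + ‖G‖ ^ r) ^ (p / r) := by
  have hp0 : 0 < p := by linarith
  have hr0 : 0 < r := hpr.pos
  have hrp : r ≤ p := by
    have := hpr.symm.sub_one_mul_conj
    nlinarith
  have hs : 1 ≤ p / r := (one_le_div hr0).2 hrp
  have hpow (F : Lp ℂ (ENNReal.ofReal p) μ) (x : Ω) : (‖F x‖ ^ r) ^ (p / r) = ‖F x‖ ^ p := by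
    rw [← Real.rpow_mul (norm_nonneg _), mul_div_cancel₀ _ hr0.ne']
  have hmeas (F : Lp ℂ (ENNReal.ofReal p) μ) : AEStronglyMeasurable (fun x => ‖F x‖ ^ r) μ :=
    ((Lp.aestronglyMeasurable F).norm.aemeasurable.pow_const r).aestronglyMeasurable
  have hn (F : Lp ℂ (ENNReal.ofReal p) μ) :
      (∫ x, (‖F x‖ ^ r) ^ (p / r) ∂μ) ^ (1 / (p / r)) = ‖F‖ ^ r := by
    simp only [hpow]
    rw [← norm_rpow_eq_integral hp0, ← Real.rpow_mul (norm_nonneg _)]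
    congr 1
    field_simp
  have hi (F : Lp ℂ (ENNReal.ofReal p) μ) : Integrable (fun x => (‖F x‖ ^ r) ^ (p / r)) μ := by
    simpa only [hpow] using integrable_norm_coeFn_rpow hp0 F
  -- Triangle inequality in L^(p/r) for |F|^r and |G|^r.
  obtain ⟨hint, hmink⟩ := integral_add_rpow_le (ν := μ) hs
    (u := fun x => ‖F x‖ ^ r) (v := fun x => ‖G x‖ ^ r)
    (fun x => by positivity) (fun x => by positivity) (hmeas F) (hmeas G) (hi F) (hi G)
  rw [hn, hn] at hmink
  rw [norm_rpow_eq_integral hp0, norm_rpow_eq_integral hp0,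
    ← integral_add (integrable_norm_coeFn_rpow hp0 _) (integrable_norm_coeFn_rpow hp0 _)]
  calc ∫ x, ‖(F + G : Lp ℂ (ENNReal.ofReal p) μ) x‖ ^ p +
          ‖(F - G : Lp ℂ (ENNReal.ofReal p) μ) x‖ ^ p ∂μ
      ≤ ∫ x, 2 * (‖F x‖ ^ r + ‖G x‖ ^ r) ^ (p / r) ∂μ := by
        refine integral_mono_ae ((integrable_norm_coeFn_rpow hp0 _).add
          (integrable_norm_coeFn_rpow hp0 _)) (hint.const_mul 2) ?_
        filter_upwards [Lp.coeFn_add F G, Lp.coeFn_sub F G] with x h1 h2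
        simp only [h1, h2, Pi.add_apply, Pi.sub_apply]
        exact norm_add_rpow_add_norm_sub_rpow_le hp hpr _ _
    _ = 2 * ∫ x, (‖F x‖ ^ r + ‖G x‖ ^ r) ^ (p / r) ∂μ := integral_const_mul _ _
    _ ≤ _ := by gcongr

/-- Clarkson's inequality in `L^p`, `1 < p < 2`. -/
lemma Lp_norm_add_rpow_add_norm_sub_rpow_le_of_lt_two {q : ℝ} (hp : p < 2)
    (hpq : p.HolderConjugate q) (F G : Lp ℂ (ENNReal.ofReal p) μ) :
    ‖F + G‖ ^ q + ‖F - G‖ ^ q ≤ 2 * (‖F‖ ^ p + ‖G‖ ^ p) ^ (q / p) := by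
  have hp0 : 0 < p := hpq.pos
  have hq0 : 0 < q := hpq.symm.pos
  have hq : 2 < q := by
    have := hpq.sub_one_mul_conj
    nlinarith [hpq.lt]
  have hs : 1 < q / p := (one_lt_div hp0).2 (by linarith)
  have hpow (t : ℝ) (ht : 0 ≤ t) : (t ^ p) ^ (q / p) = t ^ q := by
    rw [← Real.rpow_mul ht, mul_div_cancel₀ _ hp0.ne']
  have hi := integrable_norm_coeFn_rpow (μ := μ) hp0
  -- The weight 2^(p/q) in `w` below becomes Clarkson's factor 2 after raising to q/p.
  have hc : ((2 : ℝ) ^ (p / q)) ^ (q / p) = 2 := by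
    rw [← Real.rpow_mul zero_le_two, show p / q * (q / p) = 1 by field_simp, Real.rpow_one]
  have key := integral_rpow_add_integral_rpow_le (ν := μ) hs
    (u := fun x => ‖(F + G : Lp ℂ (ENNReal.ofReal p) μ) x‖ ^ p)
    (v := fun x => ‖(F - G : Lp ℂ (ENNReal.ofReal p) μ) x‖ ^ p)
    (w := fun x => 2 ^ (p / q) * (‖F x‖ ^ p + ‖G x‖ ^ p))
    (fun x => by positivity) (fun x => by positivity) (fun x => by positivity)
    (hi _) (hi _) (((hi F).add (hi G)).const_mul _) (by
      filter_upwards [Lp.coeFn_add F G, Lp.coeFn_sub F G] with x h1 h2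
      simp only [h1, h2, Pi.add_apply, Pi.sub_apply]
      rw [hpow _ (norm_nonneg _), hpow _ (norm_nonneg _),
        Real.mul_rpow (by positivity) (by positivity), hc]
      exact norm_add_rpow_add_norm_sub_rpow_le hq.le hpq _ _)
  rw [integral_const_mul, integral_add (hi F) (hi G), ← norm_rpow_eq_integral hp0,
    ← norm_rpow_eq_integral hp0, ← norm_rpow_eq_integral hp0, ← norm_rpow_eq_integral hp0,
    hpow _ (norm_nonneg _), hpow _ (norm_nonneg _),
    Real.mul_rpow (by positivity) (by positivity), hc] at key
  exact key

end Lp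

/-! ### From two points to sums over the torus -/

section Torus

variable {n : ℕ}

instance : (torusHaar n).IsHaarMeasure := by unfold torusHaar; infer_instance

instance : IsProbabilityMeasure (torusHaar n) :=
  ⟨Measure.haarMeasure_self (K₀ := (⊤ : TopologicalSpace.PositiveCompacts (Fin n → Circle)))⟩

variable {E : Type*} [NormedAddCommGroup E] [NormedSpace ℂ E]

lemma continuous_norm_sum_rpow (f : Fin n → E) (s : Finset (Fin n)) {q : ℝ} (hq : 0 ≤ q) :
    Continuous fun z : Fin n → Circle => ‖∑ j ∈ s, (z j : ℂ) • f j‖ ^ q := by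
  have h : Continuous fun z : Fin n → Circle => ∑ j ∈ s, (z j : ℂ) • f j := by fun_prop
  exact h.norm.rpow_const fun _ => Or.inr hq

lemma integrable_norm_sum_rpow (f : Fin n → E) (s : Finset (Fin n)) {q : ℝ} (hq : 0 ≤ q) :
    Integrable (fun z : Fin n → Circle => ‖∑ j ∈ s, (z j : ℂ) • f j‖ ^ q) (torusHaar n) :=
  (continuous_norm_sum_rpow f s hq).integrable_of_hasCompactSupport (.of_compactSpace _)

/-- A two-point inequality in a complex normed space passes to Steinhaus sums. -/
theorem integral_norm_sum_rpow_le {q r : ℝ} (hr : 0 < r) (hrq : r ≤ q)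
    (hE : ∀ x y : E, ‖x + y‖ ^ q + ‖x - y‖ ^ q ≤ 2 * (‖x‖ ^ r + ‖y‖ ^ r) ^ (q / r))
    (f : Fin n → E) (s : Finset (Fin n)) :
    ∫ z, ‖∑ j ∈ s, (z j : ℂ) • f j‖ ^ q ∂(torusHaar n) ≤ (∑ j ∈ s, ‖f j‖ ^ r) ^ (q / r) := by
  have hq : 0 < q := hr.trans_le hrq
  have hs : 1 ≤ q / r := (one_le_div hr).2 hrq
  have hpow (t : ℝ) (ht : 0 ≤ t) : (t ^ r) ^ (q / r) = t ^ q := by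
    rw [← Real.rpow_mul ht, mul_div_cancel₀ _ hr.ne']
  induction s using Finset.induction_on with
  | empty => simp [hq.ne', Real.zero_rpow (div_pos hq hr).ne']
  | insert k s hk ih =>
    set X : (Fin n → Circle) → E := fun z => ∑ j ∈ s, (z j : ℂ) • f j with hX
    have hsum : ∀ z : Fin n → Circle,
        ∑ j ∈ insert k s, (z j : ℂ) • f j = X z + (z k : ℂ) • f k := fun z => by
      rw [Finset.sum_insert hk, add_comm]
    have hplus := integrable_norm_sum_rpow f (insert k s) hq.le
    simp only [hsum] at hplus ⊢
    -- Translation by `e` flips the sign of z_k and fixes `X`, which does not involve z_k.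
    set e : Fin n → Circle := Function.update 1 k (-1) with he
    have hXe : ∀ z, X (e * z) = X z := fun z => by
      refine Finset.sum_congr rfl fun j hj => ?_
      have hjk : j ≠ k := fun h => hk (h ▸ hj)
      simp [he, hjk]
    have hflip : ∀ z, X (e * z) + ((e * z) k : ℂ) • f k = X z - (z k : ℂ) • f k := fun z => by
      rw [hXe]; simp [he, sub_eq_add_neg]
    have hminus : Integrable (fun z => ‖X z - (z k : ℂ) • f k‖ ^ q) (torusHaar n) := by
      simpa only [hflip] using hplus.comp_mul_left e
    have hinv : ∫ z, ‖X z - (z k : ℂ) • f k‖ ^ q ∂(torusHaar n) =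
        ∫ z, ‖X z + (z k : ℂ) • f k‖ ^ q ∂(torusHaar n) := by
      rw [← integral_mul_left_eq_self (fun z => ‖X z + (z k : ℂ) • f k‖ ^ q) e]
      simp only [hflip]
    obtain ⟨hint, hmink⟩ := integral_add_rpow_le (ν := torusHaar n) hs
      (u := fun z => ‖X z‖ ^ r) (v := fun _ => ‖f k‖ ^ r)
      (fun z => by positivity) (fun z => by positivity)
      (continuous_norm_sum_rpow f s hr.le).aestronglyMeasurable aestronglyMeasurable_const
      (by simpa only [hpow _ (norm_nonneg _)] using integrable_norm_sum_rpow f s hq.le)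
      (integrable_const _)
    have hconst : (∫ _ : Fin n → Circle, (‖f k‖ ^ r) ^ (q / r) ∂(torusHaar n)) ^ (1 / (q / r)) =
        ‖f k‖ ^ r := by
      rw [integral_const, probReal_univ, one_smul, ← Real.rpow_mul (by positivity),
        mul_one_div_cancel (by positivity), Real.rpow_one]
    have hIX : (∫ z, (‖X z‖ ^ r) ^ (q / r) ∂(torusHaar n)) ^ (1 / (q / r)) ≤
        ∑ j ∈ s, ‖f j‖ ^ r := by
      have h0 : 0 ≤ ∑ j ∈ s, ‖f j‖ ^ r := Finset.sum_nonneg fun j _ => by positivity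
      simp only [hpow _ (norm_nonneg _)]
      calc (∫ z, ‖X z‖ ^ q ∂(torusHaar n)) ^ (1 / (q / r))
          ≤ ((∑ j ∈ s, ‖f j‖ ^ r) ^ (q / r)) ^ (1 / (q / r)) :=
            Real.rpow_le_rpow (integral_nonneg fun z => by positivity) ih (by positivity)
        _ = _ := by rw [← Real.rpow_mul h0, mul_one_div_cancel (by positivity), Real.rpow_one]
    have htwo : 2 * ∫ z, ‖X z + (z k : ℂ) • f k‖ ^ q ∂(torusHaar n) ≤
        2 * ∫ z, (‖X z‖ ^ r + ‖f k‖ ^ r) ^ (q / r) ∂(torusHaar n) := by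
      calc 2 * ∫ z, ‖X z + (z k : ℂ) • f k‖ ^ q ∂(torusHaar n)
          = ∫ z, ‖X z + (z k : ℂ) • f k‖ ^ q + ‖X z - (z k : ℂ) • f k‖ ^ q ∂(torusHaar n) := by
            rw [integral_add hplus hminus, hinv, two_mul]
        _ ≤ ∫ z, 2 * (‖X z‖ ^ r + ‖f k‖ ^ r) ^ (q / r) ∂(torusHaar n) := by
            refine integral_mono (hplus.add hminus) (hint.const_mul 2) fun z => ?_
            simpa [norm_smul, Circle.norm_coe] using hE (X z) ((z k : ℂ) • f k)
        _ = _ := integral_const_mul _ _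
    refine (le_of_mul_le_mul_left htwo two_pos).trans (hmink.trans ?_)
    rw [hconst, Finset.sum_insert hk, add_comm (‖f k‖ ^ r)]
    gcongr

theorem integrable_and_integral_norm_sum_le {q r : ℝ} (hr : 0 < r) (hrq : r ≤ q)
    (hE : ∀ x y : E, ‖x + y‖ ^ q + ‖x - y‖ ^ q ≤ 2 * (‖x‖ ^ r + ‖y‖ ^ r) ^ (q / r))
    (f : Fin n → E) :
    Integrable (fun z : Fin n → Circle => ‖∑ j, (z j : ℂ) • f j‖ ^ q) (torusHaar n) ∧
      (∫ z, ‖∑ j, (z j : ℂ) • f j‖ ^ q ∂(torusHaar n)) ^ (1 / q) ≤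
        (∑ j, ‖f j‖ ^ r) ^ (1 / r) := by
  have hq : 0 < q := hr.trans_le hrq
  refine ⟨integrable_norm_sum_rpow f _ hq.le, ?_⟩
  have h0 : 0 ≤ ∑ j, ‖f j‖ ^ r := Finset.sum_nonneg fun j _ => by positivity
  refine (Real.rpow_le_rpow (integral_nonneg fun z => by positivity)
    (integral_norm_sum_rpow_le hr hrq hE f Finset.univ) (by positivity)).trans_eq ?_
  rw [← Real.rpow_mul h0]
  congr 1
  field_simp

end Torus

end Clarkson

theorem lemma3p1 {Ω : Type*} [MeasurableSpace Ω] (μ : Measure Ω) (n : ℕ)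
    (p : ℝ) [Fact (1 ≤ ENNReal.ofReal p)] (f : Fin n → Lp ℂ (ENNReal.ofReal p) μ) :
    -- `p = 1`, where `p' = ∞` and the left-hand side is a supremum
    (p = 1 → ∀ z : Fin n → Circle, ‖Clarkson.steinhausSum f z‖ ≤ ∑ j, ‖f j‖) ∧
    -- `1 < p ≤ 2`, with `p' = p / (p - 1)`
    (1 < p → p ≤ 2 →
      Integrable (fun z => ‖Clarkson.steinhausSum f z‖ ^ (p / (p - 1))) (Clarkson.torusHaar n) ∧
      (∫ z, ‖Clarkson.steinhausSum f z‖ ^ (p / (p - 1)) ∂(Clarkson.torusHaar n))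
          ^ (1 / (p / (p - 1))) ≤
        (∑ j, ‖f j‖ ^ p) ^ (1 / p)) ∧
    -- `2 ≤ p < ∞`
    (2 ≤ p →
      Integrable (fun z => ‖Clarkson.steinhausSum f z‖ ^ p) (Clarkson.torusHaar n) ∧
      (∫ z, ‖Clarkson.steinhausSum f z‖ ^ p ∂(Clarkson.torusHaar n)) ^ (1 / p) ≤
        (∑ j, ‖f j‖ ^ (p / (p - 1))) ^ (1 / (p / (p - 1)))) := by
  have hge (hp : 2 ≤ p) :
      Integrable (fun z => ‖Clarkson.steinhausSum f z‖ ^ p) (Clarkson.torusHaar n) ∧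
      (∫ z, ‖Clarkson.steinhausSum f z‖ ^ p ∂(Clarkson.torusHaar n)) ^ (1 / p) ≤
        (∑ j, ‖f j‖ ^ (p / (p - 1))) ^ (1 / (p / (p - 1))) := by
    have hpr : p.HolderConjugate (p / (p - 1)) := .conjExponent (by linarith)
    refine Clarkson.integrable_and_integral_norm_sum_le hpr.symm.pos ?_
      (Clarkson.Lp_norm_add_rpow_add_norm_sub_rpow_le_of_two_le hp hpr.symm) f
    exact div_le_self (by linarith) (by linarith)
  refine ⟨fun _ z => ?_, fun hp1 hp2 => ?_, hge⟩
  · refine (norm_sum_le _ _).trans_eq ?_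
    simp [norm_smul, Circle.norm_coe]
  · rcases hp2.lt_or_eq with hp2 | rfl
    · have hpq : p.HolderConjugate (p / (p - 1)) := .conjExponent hp1
      refine Clarkson.integrable_and_integral_norm_sum_le hpq.pos ?_
        (Clarkson.Lp_norm_add_rpow_add_norm_sub_rpow_le_of_lt_two hp2 hpq) f
      rw [le_div_iff₀ (by linarith)]
      nlinarith
    -- At p = 2 = p' the two inequalities coincide.
    · have h := hge le_rfl
      norm_num at h ⊢
      exact h
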